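/- Let $f$ be a real-valued function that is concave and non-decreasing on $[0,\infty)$ with $f(0)=0$. Let $X\in\mathbb{R}^{m\times n}$ have rank at most $k$, let $\sigma_1(X)\ge\sigma_2(X)\ge\dots\ge 0$ be its singular values (with $\sigma_i(X)=0$ for $i>\min(m,n)$), and let $\mathcal{R}(X)=\sum_{i=1}^{\min(m,n)} f(\sigma_i(X))$. Then $$\mathcal{R}(X)=\min_{BC^T=X}\ \sum_{i=1}^k f(\|B_i\|\,\|C_i\|),$$ where the minimum is over all $B\in\mathbb{R}^{m\times k}$ and $C\in\mathbb{R}^{n\times k}$ with $BC^T=X$, $B_i$ and $C_i$ are the $i$-th columns of $B$ and $C$, and $\|\cdot\|$ is the Euclidean norm. Moreover, $X$ has a singular value decomposition $X=\sum_{i=1}^k\sigma_i(X)\,U_iV_i^T$ (the $U_i$ with $\sigma_i(X)\neq 0$ are orthonormal, and so are the $V_i$ with $\sigma_i(X)\neq 0$), and for every such decomposition the factors with columns $B_i=\sqrt{\sigma_i(X)}\,U_i$ and $C_i=\sqrt{\sigma_i(X)}\,V_i$ satisfy $BC^T=X$ and attain the minimum. -/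

import Mathlib

noncomputable section

/-- The `i`-th singular value of a real `m × n` matrix, in non-increasing order, with multiplicity,
indexed from `0`. It is `0` for `i ≥ min m n`. -/
def singVal {m n : ℕ} (X : Matrix (Fin m) (Fin n) ℝ) (i : ℕ) : ℝ :=
  (Matrix.toEuclideanLin X).singularValues i

/-- The spectral penalty `R(X) = ∑ f(σᵢ(X))`, the sum running over the `min m n` singular values
of `X`. -/
def spectralPenalty {m n : ℕ} (f : ℝ → ℝ) (X : Matrix (Fin m) (Fin n) ℝ) : ℝ :=
  ∑ i ∈ Finset.range (min m n), f (singVal X i)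

/-- The Euclidean norm of the `i`-th column of a matrix. -/
def colNorm {m k : ℕ} (B : Matrix (Fin m) (Fin k) ℝ) (i : Fin k) : ℝ :=
  ‖WithLp.toLp 2 (B.col i)‖

/-- The penalty `∑ᵢ f(‖Bᵢ‖ ‖Cᵢ‖)` on a pair of factors with `k` columns each. -/
def factorPenalty {m n k : ℕ} (f : ℝ → ℝ) (B : Matrix (Fin m) (Fin k) ℝ)
    (C : Matrix (Fin n) (Fin k) ℝ) : ℝ :=
  ∑ i : Fin k, f (colNorm B i * colNorm C i)

/-- The columns of `U` and `V` are left and right singular vectors in a singular value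
decomposition `X = ∑ᵢ σᵢ(X) Uᵢ Vᵢᵀ` with `k` terms: those belonging to nonzero singular values are
orthonormal. The columns belonging to zero singular values do not contribute to the sum and are
left free, since for `k > min m n` no `k` orthonormal columns exist. -/
structure IsSVD {m n k : ℕ} (X : Matrix (Fin m) (Fin n) ℝ) (U : Matrix (Fin m) (Fin k) ℝ)
    (V : Matrix (Fin n) (Fin k) ℝ) : Prop where
  left_orthonormal : Orthonormal ℝ
    (fun i : {i : Fin k // singVal X i ≠ 0} => WithLp.toLp 2 (U.col i.1))
  right_orthonormal : Orthonormal ℝ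
    (fun i : {i : Fin k // singVal X i ≠ 0} => WithLp.toLp 2 (V.col i.1))
  eq_sum : X = ∑ i : Fin k, singVal X i • Matrix.vecMulVec (U.col i) (V.col i)

/-- The matrix whose `i`-th column is `√σᵢ(X)` times the `i`-th column of `W`. -/
def balancedFactor {m n l k : ℕ} (X : Matrix (Fin m) (Fin n) ℝ) (W : Matrix (Fin l) (Fin k) ℝ) :
    Matrix (Fin l) (Fin k) ℝ :=
  Matrix.of fun a i => Real.sqrt (singVal X i) * W a i

end

/-! Write `X = BCᵀ` and `aᵢ = ‖Bᵢ‖‖Cᵢ‖`. Deleting the terms in `J` changes `X` by rank at most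
`|J|`, so what remains has nuclear norm at least the tail `∑_{i ≥ |J|} σᵢ`
(`LinearMap.tail_singularValues_le`). Taking for `J` the indices of the largest `aᵢ`, every tail sum
of the sorted `a` dominates that of `σ`. A concave non-decreasing `f` turns this into `∑ f(σᵢ) ≤ ∑
f(aᵢ)`: bound `f` by its supergradients at the `aᵢ`, whose slopes are non-negative and increase as
`aᵢ` decreases, and sum by parts. The balanced SVD factors have `aᵢ = σᵢ`, giving equality. -/

/-! ### Tail-sum majorization and concave functions -/

open Finset in
/-- Summation by parts: if all tail sums of `e` are non-negative, then replacing increasing weights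
by their first value decreases the weighted sum of `e`. -/
lemma head_weight_mul_sum_le_weighted_sum (k : ℕ) (c e : ℕ → ℝ)
    (hc : ∀ i, i + 1 < k → c i ≤ c (i + 1))
    (he : ∀ j ≤ k, 0 ≤ ∑ i ∈ Ico j k, e i) :
    c 0 * ∑ i ∈ range k, e i ≤ ∑ i ∈ range k, c i * e i := by
  induction k generalizing c e with
  | zero => simp
  | succ k ih =>
    have htail : ∀ j ≤ k, 0 ≤ ∑ i ∈ Ico j k, e (i + 1) := by
      intro j hj
      have := he (j + 1) (by omega)
      rwa [← Finset.sum_Ico_add' e j k 1] at this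
    have h1 := ih (fun i => c (i + 1)) (fun i => e (i + 1)) (fun i hi => hc (i + 1) (by omega)) htail
    rw [sum_range_succ', sum_range_succ', mul_add]
    rcases Nat.eq_zero_or_pos k with rfl | hk
    · simp
    have h2 := mul_le_mul_of_nonneg_right (hc 0 (by omega)) (htail 0 (by omega))
    simp only [Nat.Ico_zero_eq_range, zero_add] at h2 h1
    linarith

/-- A concave function on `[0, ∞)` has a supergradient at every positive point. -/
lemma ConcaveOn.exists_supergradient_of_pos {f : ℝ → ℝ} (hf : ConcaveOn ℝ (Set.Ici 0) f) {x : ℝ}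
    (hx : 0 < x) : ∃ c, ∀ y, 0 ≤ y → f y ≤ f x + c * (y - x) := by
  obtain ⟨c, hc1, hc2⟩ := exists_between_of_forall_le
    (s := {c | ∃ y, x < y ∧ c = (f y - f x) / (y - x)})
    (t := {c | ∃ y, 0 ≤ y ∧ y < x ∧ c = (f x - f y) / (x - y)})
    ⟨_, x + 1, by linarith, rfl⟩ ⟨_, 0, le_rfl, hx, rfl⟩ (by
      rintro _ ⟨y, hy, rfl⟩ _ ⟨z, hz, hzx, rfl⟩
      exact hf.slope_anti_adjacent (Set.mem_Ici.2 hz) (Set.mem_Ici.2 (hx.trans hy).le) hzx hy)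
  refine ⟨c, fun y hy => ?_⟩
  rcases lt_trichotomy y x with h | rfl | h
  · have := hc2 ⟨y, hy, h, rfl⟩
    rw [le_div_iff₀ (by linarith)] at this
    linarith
  · simp
  · have := hc1 ⟨y, h, rfl⟩
    rw [div_le_iff₀ (by linarith)] at this
    linarith

open Finset in
/-- Domination of all tail sums of a decreasing sequence passes to sums of a concave
non-decreasing function. -/
lemma ConcaveOn.sum_le_sum_of_tail_sum_le {f : ℝ → ℝ} (hf : ConcaveOn ℝ (Set.Ici 0) f)
    (hmono : MonotoneOn f (Set.Ici 0)) (k : ℕ) (a s : ℕ → ℝ)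
    (ha : ∀ i j, i ≤ j → j < k → a j ≤ a i) (ha0 : ∀ i < k, 0 ≤ a i) (hs0 : ∀ i, 0 ≤ s i)
    (h : ∀ j ≤ k, ∑ i ∈ Ico j k, s i ≤ ∑ i ∈ Ico j k, a i) :
    ∑ i ∈ range k, f (s i) ≤ ∑ i ∈ range k, f (a i) := by
  induction k with
  | zero => simp
  | succ k ih =>
    -- The slope of `f` at `0` may be infinite, so a vanishing last `a k` is peeled off: it forces
    -- `s k = 0`.
    rcases (ha0 k (by omega)).eq_or_lt with h0 | h0
    · have hsk : s k = 0 := by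
        have := h k (by omega)
        simp only [Nat.Ico_succ_singleton, sum_singleton] at this
        linarith [hs0 k]
      rw [sum_range_succ, sum_range_succ, hsk, ← h0]
      gcongr ?_ + _
      refine ih (fun i j hij hj => ha i j hij (by omega)) (fun i hi => ha0 i (by omega)) ?_
      intro j hj
      have := h j (by omega)
      rwa [sum_Ico_succ_top hj, sum_Ico_succ_top hj, hsk, ← h0, add_zero, add_zero] at this
    · choose! g hg using fun x (hx : 0 < x) => hf.exists_supergradient_of_pos hx
      have hpos : ∀ i < k + 1, 0 < a i := fun i hi => h0.trans_le (ha i k (by omega) (by omega))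
      have hg0 : ∀ x, 0 < x → 0 ≤ g x := by
        intro x hx
        have h1 := hg x hx (x + 1) (by linarith)
        have h2 := hmono (Set.mem_Ici.2 hx.le) (Set.mem_Ici.2 (by linarith : (0 : ℝ) ≤ x + 1))
          (by linarith)
        linarith
      have hanti : ∀ x y, 0 < x → x ≤ y → g y ≤ g x := by
        intro x y hx hxy
        rcases hxy.eq_or_lt with rfl | hlt
        · exact le_rfl
        have h1 := hg x hx y (by linarith)
        have h2 := hg y (by linarith) x hx.le
        -- Adding `h1` and `h2` gives `(g y - g x) * (y - x) ≤ 0`.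
        nlinarith
      have habel := head_weight_mul_sum_le_weighted_sum (k + 1) (fun i => g (a i))
        (fun i => a i - s i)
        (fun i hi => hanti _ _ (hpos _ hi) (ha _ _ (by omega) hi))
        (fun j hj => by rw [sum_sub_distrib]; linarith [h j hj])
      have hnn : 0 ≤ g (a 0) * ∑ i ∈ range (k + 1), (a i - s i) := by
        refine mul_nonneg (hg0 _ (hpos 0 (by omega))) ?_
        have := h 0 (by omega)
        simp only [Nat.Ico_zero_eq_range] at this
        rw [sum_sub_distrib]
        linarith
      have hsum : ∑ i ∈ range (k + 1), f (s i) ≤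
          ∑ i ∈ range (k + 1), (f (a i) - g (a i) * (a i - s i)) :=
        sum_le_sum fun i hi => by
          linarith [hg (a i) (hpos i (mem_range.1 hi)) (s i) (hs0 i)]
      rw [sum_sub_distrib] at hsum
      linarith

open Finset in
/-- Variant of `ConcaveOn.sum_le_sum_of_tail_sum_le` for an unsorted majorant. -/
lemma ConcaveOn.sum_le_sum_of_compl_sum {f : ℝ → ℝ} (hf : ConcaveOn ℝ (Set.Ici 0) f)
    (hmono : MonotoneOn f (Set.Ici 0)) {k : ℕ} (a : Fin k → ℝ) (s : ℕ → ℝ)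
    (ha0 : ∀ i, 0 ≤ a i) (hs0 : ∀ i, 0 ≤ s i)
    (h : ∀ J : Finset (Fin k), ∑ i ∈ Ico #J k, s i ≤ ∑ i ∈ Jᶜ, a i) :
    ∑ i ∈ range k, f (s i) ≤ ∑ i, f (a i) := by
  set p := Tuple.sort (fun i => -a i) with hp
  have hsort : Monotone ((fun i => -a i) ∘ p) := Tuple.monotone_sort _
  set b : ℕ → ℝ := fun i => if hi : i < k then a (p ⟨i, hi⟩) else 0 with hb
  have hbv : ∀ i : Fin k, b i = a (p i) := fun i => by simp [hb]
  have hfin : ∑ i, f (a i) = ∑ i ∈ range k, f (b i) := by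
    rw [← Fin.sum_univ_eq_sum_range (fun i => f (b i)), ← Equiv.sum_comp p]
    simp [hbv]
  rw [hfin]
  refine hf.sum_le_sum_of_tail_sum_le hmono k b s ?_ ?_ hs0 ?_
  · intro i j hij hj
    have := hsort (show (⟨i, by omega⟩ : Fin k) ≤ ⟨j, hj⟩ from hij)
    simpa [hb, hj, hij.trans_lt hj] using this
  · intro i hi
    simpa [hb, hi] using ha0 _
  · intro j hj
    set J : Finset (Fin k) := (univ.filter fun i : Fin k => (i : ℕ) < j).map p.toEmbedding with hJ
    have hcard : #J = j := by
      rw [hJ, card_map, Fin.card_filter_val_lt, min_eq_right hj]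
    have hJc : Jᶜ = (univ.filter fun i : Fin k => j ≤ (i : ℕ)).map p.toEmbedding := by
      ext i
      obtain ⟨i, rfl⟩ := p.surjective i
      simp [hJ]
    have := h J
    rw [hcard, hJc, sum_map] at this
    refine this.trans (le_of_eq ?_)
    have h2 : Ico j k = (range k).filter (fun i => j ≤ i) := by
      ext i; simp [and_comm]
    rw [h2, sum_filter, sum_filter, ← Fin.sum_univ_eq_sum_range (fun i => if j ≤ i then b i else 0)]
    simp [hbv]

/-! ### Singular vectors and tails of singular values -/

section SingularVectors

open Module RealInnerProductSpace Finset

/-- Bessel's inequality for a family that is orthonormal off the indices where it vanishes. -/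
lemma Orthonormal.sum_sq_inner_le_of_vanish {F ι : Type*} [NormedAddCommGroup F]
    [InnerProductSpace ℝ F] [Fintype ι] {p : ι → Prop} [DecidablePred p] {x : ι → F}
    (hx : Orthonormal ℝ (fun i : {i // p i} => x i.1)) (h0 : ∀ i, ¬ p i → x i = 0) (u : F) :
    ∑ i, ⟪x i, u⟫ ^ 2 ≤ ‖u‖ ^ 2 := by
  have h := hx.sum_inner_products_le (s := univ) u
  simp only [Real.norm_eq_abs, sq_abs] at h
  refine le_trans (le_of_eq ?_) h
  rw [← Finset.sum_subtype (univ.filter p) (by simp) (fun i => ⟪x i, u⟫ ^ 2)]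
  refine (sum_filter_of_ne fun i _ hi => ?_).symm
  by_contra hp
  simp [h0 i hp] at hi

variable {E F : Type*} [NormedAddCommGroup E] [InnerProductSpace ℝ E] [FiniteDimensional ℝ E]
  [NormedAddCommGroup F] [InnerProductSpace ℝ F] [FiniteDimensional ℝ F]

/-- Diagonalize `T*T` and normalize the images of its eigenvectors. Setting `x i = 0` at zero
singular values avoids completing the `x i` to an orthonormal family, which may be impossible in
`F`. -/
lemma LinearMap.exists_singular_vectors (T : E →ₗ[ℝ] F) {n : ℕ} (hn : finrank ℝ E = n) :
    ∃ (y : OrthonormalBasis (Fin n) ℝ E) (x : Fin n → F),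
      Orthonormal ℝ (fun i : {i : Fin n // T.singularValues i ≠ 0} => x i.1) ∧
      (∀ i : Fin n, T.singularValues i = 0 → x i = 0) ∧
      (∀ i : Fin n, T (y i) = T.singularValues i • x i) ∧
      ∀ (i : Fin n) w, ⟪x i, T w⟫ = T.singularValues i * ⟪y i, w⟫ := by
  set y := T.isSymmetric_adjoint_comp_self.eigenvectorBasis hn with hy
  have hTT : ∀ (i : Fin n) w, ⟪T (y i), T w⟫ = T.singularValues i ^ 2 * ⟪y i, w⟫ := by
    intro i w
    have h1 := T.isSymmetric_adjoint_comp_self.apply_eigenvectorBasis hn i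
    rw [← LinearMap.adjoint_inner_left, ← LinearMap.comp_apply, h1, T.sq_singularValues_fin hn i,
      inner_smul_left]
    rfl
  have hker : ∀ i : Fin n, T.singularValues i = 0 → T (y i) = 0 := by
    intro i hi
    have := hTT i (y i)
    rw [hi] at this
    simpa using this
  refine ⟨y, fun i => (T.singularValues i)⁻¹ • T (y i), ?_, ?_, ?_, ?_⟩
  · rw [orthonormal_iff_ite]
    rintro ⟨i, hi⟩ ⟨j, hj⟩
    rw [inner_smul_left, inner_smul_right, hTT, orthonormal_iff_ite.1 y.orthonormal]
    by_cases hij : i = j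
    · subst hij
      simp
      field_simp
    · simp [hij]
  · intro i hi
    simp [hi]
  · intro i
    by_cases hi : T.singularValues i = 0
    · simp [hi, hker i hi]
    · rw [smul_smul, mul_inv_cancel₀ hi, one_smul]
  · intro i w
    rw [inner_smul_left, hTT]
    by_cases hi : T.singularValues i = 0
    · simp [hi]
    · simp
      field_simp

/-- Ky Fan's minimum principle for weights: weights in `[0, 1]` of total mass at least `n - j`
give a decreasing non-negative sequence at least its tail sum from `j` on. -/
lemma tail_sum_le_weighted_sum {n : ℕ} (s : ℕ → ℝ) (hs : Antitone s) (hs0 : ∀ i, 0 ≤ s i)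
    (t : Fin n → ℝ) (ht0 : ∀ i, 0 ≤ t i) (ht1 : ∀ i, t i ≤ 1) (j : ℕ)
    (ht : (n : ℝ) - j ≤ ∑ i, t i) :
    ∑ i : Fin n with j ≤ i.1, s i ≤ ∑ i : Fin n, s i * t i := by
  -- This is `(s i - s j) * (t i - 1_{j ≤ i}) ≥ 0`: the two factors never have opposite signs.
  have hterm : ∀ i : Fin n, s j * (t i - if j ≤ i.1 then 1 else 0) ≤
      s i * t i - if j ≤ i.1 then s i else 0 := by
    intro i
    split_ifs with h
    · nlinarith [hs h, ht1 i]
    · nlinarith [hs (not_le.1 h).le, ht0 i]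
  have hsum := Finset.sum_le_sum fun i (_ : i ∈ univ) => hterm i
  rw [← mul_sum, sum_sub_distrib, sum_sub_distrib, ← sum_filter, ← sum_filter] at hsum
  have hcard : (∑ i : Fin n with j ≤ i.1, (1 : ℝ)) ≤ ∑ i, t i ∨ s j = 0 ∨ n < j := by
    by_cases hj : j ≤ n
    · left
      refine le_trans (le_of_eq ?_) ht
      have h1 := Finset.card_filter_add_card_filter_not (s := (univ : Finset (Fin n)))
        (fun i : Fin n => (i : ℕ) < j)
      rw [Fin.card_filter_val_lt, min_eq_right hj, card_univ, Fintype.card_fin] at h1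
      simp only [not_lt] at h1
      rw [sum_const, nsmul_eq_mul, mul_one, eq_sub_iff_add_eq']
      exact_mod_cast h1
    · right; right; omega
  rcases hcard with h | h | h
  · have := mul_nonneg (hs0 j) (sub_nonneg.2 h)
    linarith
  · rw [h, zero_mul] at hsum
    linarith
  · rw [Finset.filter_false_of_mem (fun i _ => by omega), sum_empty]
    exact sum_nonneg fun i _ => mul_nonneg (hs0 i) (ht0 i)

/-- If `T = ∑ᵢ ⟪cᵢ, ·⟫ bᵢ` then, after deleting the terms with `i ∈ J`, the remaining ones dominate
the tail of the singular values of `T` from `|J|` on. -/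
lemma LinearMap.tail_singularValues_le {ι : Type*} [Fintype ι] [DecidableEq ι] (T : E →ₗ[ℝ] F)
    {n : ℕ} (hn : finrank ℝ E = n) (b : ι → F) (c : ι → E)
    (hT : ∀ w, T w = ∑ i, ⟪c i, w⟫ • b i) (J : Finset ι) :
    ∑ i : Fin n with #J ≤ i.1, T.singularValues i ≤ ∑ i ∈ Jᶜ, ‖b i‖ * ‖c i‖ := by
  obtain ⟨y, x, hx, hx0, -, hxT⟩ := T.exists_singular_vectors hn
  classical
  set K : Submodule ℝ E := Submodule.span ℝ (J.image c : Set E) with hK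
  set w := stdOrthonormalBasis ℝ Kᗮ with hw
  have hwo : Orthonormal ℝ (fun l => (w l : E)) :=
    w.orthonormal.comp_linearIsometry Kᗮ.subtypeₗᵢ
  have hKdim : finrank ℝ K ≤ #J :=
    (finrank_span_finset_le_card _).trans card_image_le
  have hKadd := K.finrank_add_finrank_orthogonal
  have hcw : ∀ i ∈ J, ∀ l, ⟪c i, (w l : E)⟫ = 0 := fun i hi l =>
    Submodule.inner_right_of_mem_orthogonal
      (Submodule.subset_span (by simpa using ⟨i, hi, rfl⟩)) (w l).2
  -- `q` is the adjoint of the partial isometry in the polar decomposition: a contraction with `q ∘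
  -- T = √(T*T)`. The trace of `q ∘ T` compressed to `Kᗮ`, where the terms in `J` vanish, is bounded
  -- from both sides.
  set q : F → E := fun u => ∑ i, ⟪x i, u⟫ • y i with hq
  have hqn : ∀ u, ‖q u‖ ≤ ‖u‖ := by
    intro u
    rw [← sq_le_sq₀ (norm_nonneg _) (norm_nonneg _)]
    have h1 : ‖q u‖ ^ 2 = ∑ i, ⟪x i, u⟫ ^ 2 := by
      rw [← real_inner_self_eq_norm_sq, hq, y.orthonormal.inner_sum]
      simp [sq]
    rw [h1]
    exact hx.sum_sq_inner_le_of_vanish (fun i hi => hx0 i (not_not.1 hi)) u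
  have hqT : ∀ v, ⟪q (T v), v⟫ = ∑ i : Fin n, T.singularValues i * ⟪y i, v⟫ ^ 2 := by
    intro v
    simp only [hq, sum_inner, inner_smul_left, hxT]
    exact sum_congr rfl fun i _ => by simp; ring
  have hqsum : ∀ v, ⟪q (T v), v⟫ = ∑ i, ⟪q (b i), v⟫ * ⟪c i, v⟫ := by
    intro v
    have hlin : q (T v) = ∑ i, ⟪c i, v⟫ • q (b i) := by
      simp only [hq, hT v, inner_sum, inner_smul_right, sum_smul, smul_sum, smul_smul]
      exact sum_comm
    rw [hlin, sum_inner]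
    exact sum_congr rfl fun i _ => by rw [inner_smul_left]; simp; ring
  have hbessel : ∀ v : E, ∑ l, ⟪(w l : E), v⟫ ^ 2 ≤ ‖v‖ ^ 2 := fun v => by
    simpa using hwo.sum_inner_products_le (s := univ) v
  -- The weights `‖P y i‖²`, with `P` the projection onto `Kᗮ`, have total mass `dim Kᗮ ≥ n - #J`.
  have hlow : ∑ i : Fin n with #J ≤ i.1, T.singularValues i ≤
      ∑ i : Fin n, T.singularValues i * ∑ l, ⟪(w l : E), y i⟫ ^ 2 := by
    refine tail_sum_le_weighted_sum (fun i => T.singularValues i) T.singularValues_antitone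
      T.singularValues_nonneg _ (fun i => sum_nonneg fun l _ => sq_nonneg _) (fun i => ?_) _ ?_
    · simpa using hbessel (y i)
    · rw [sum_comm]
      have h1 : ∀ l, ∑ i, ⟪(w l : E), y i⟫ ^ 2 = 1 := by
        intro l
        have h2 := y.sum_sq_norm_inner_left (w l : E)
        have h3 : ‖(w l : E)‖ = 1 := hwo.1 l
        rw [h3] at h2
        simpa using h2
      simp only [h1, sum_const, card_univ, Fintype.card_fin, nsmul_eq_mul, mul_one]
      rw [sub_le_iff_le_add]
      norm_cast
      omega
  have hup : ∑ l, ⟪q (T (w l)), (w l : E)⟫ ≤ ∑ i ∈ Jᶜ, ‖b i‖ * ‖c i‖ := by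
    simp only [hqsum]
    rw [sum_comm, ← sum_compl_add_sum J]
    have hzero : ∑ i ∈ J, ∑ l, ⟪q (b i), (w l : E)⟫ * ⟪c i, (w l : E)⟫ = 0 :=
      sum_eq_zero fun i hi => sum_eq_zero fun l _ => by rw [hcw i hi l, mul_zero]
    rw [hzero, add_zero]
    refine sum_le_sum fun i _ => ?_
    refine (Real.sum_mul_le_sqrt_mul_sqrt _ _ _).trans ?_
    gcongr
    · refine (Real.sqrt_le_left (norm_nonneg _)).2 ?_
      refine le_trans ?_ (pow_le_pow_left₀ (norm_nonneg _) (hqn (b i)) 2)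
      simpa only [real_inner_comm] using hbessel (q (b i))
    · refine (Real.sqrt_le_left (norm_nonneg _)).2 ?_
      simpa only [real_inner_comm] using hbessel (c i)
  refine hlow.trans (le_trans (le_of_eq ?_) hup)
  simp only [hqT, mul_sum]
  rw [sum_comm]
  simp only [real_inner_comm]

end SingularVectors

/-! ### Matrix factorizations and the penalty -/

section MatrixFactors

open Finset RealInnerProductSpace

lemma singVal_nonneg {m n : ℕ} (X : Matrix (Fin m) (Fin n) ℝ) (i : ℕ) : 0 ≤ singVal X i :=
  LinearMap.singularValues_nonneg _ i

lemma singVal_eq_zero_iff_rank_le {m n : ℕ} (X : Matrix (Fin m) (Fin n) ℝ) (i : ℕ) :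
    singVal X i = 0 ↔ X.rank ≤ i := by
  rw [singVal, LinearMap.singularValues_eq_zero_iff_le_finrank_range,
    X.rank_eq_finrank_range_toLin (EuclideanSpace.basisFun (Fin m) ℝ).toBasis
      (EuclideanSpace.basisFun (Fin n) ℝ).toBasis, Matrix.toEuclideanLin_eq_toLin_orthonormal]

lemma spectralPenalty_eq_sum_range {m n : ℕ} {f : ℝ → ℝ} (hf0 : f 0 = 0)
    (X : Matrix (Fin m) (Fin n) ℝ) {k : ℕ} (hX : X.rank ≤ k) :
    spectralPenalty f X = ∑ i ∈ range k, f (singVal X i) := by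
  have key : ∀ l, X.rank ≤ l →
      ∑ i ∈ range l, f (singVal X i) = ∑ i ∈ range X.rank, f (singVal X i) := by
    intro l hl
    refine (sum_subset (range_mono hl) fun i _ hi => ?_).symm
    rw [(singVal_eq_zero_iff_rank_le X i).2 (by simpa using hi), hf0]
  rw [spectralPenalty, key _ hX, key _ (le_min X.rank_le_height X.rank_le_width)]

lemma toEuclideanLin_mul_transpose_apply {m n k : ℕ} (B : Matrix (Fin m) (Fin k) ℝ)
    (C : Matrix (Fin n) (Fin k) ℝ) (w : EuclideanSpace ℝ (Fin n)) :
    Matrix.toEuclideanLin (B * C.transpose) w =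
      ∑ i, ⟪WithLp.toLp 2 (C.col i), w⟫ • WithLp.toLp 2 (B.col i) := by
  ext a
  simp only [Matrix.toLpLin_apply, Matrix.mulVec, dotProduct, Matrix.mul_apply,
    Matrix.transpose_apply, WithLp.ofLp_sum, Finset.sum_apply, WithLp.ofLp_smul, Pi.smul_apply,
    Matrix.col_apply, smul_eq_mul, PiLp.inner_apply, RCLike.inner_apply, conj_trivial, sum_mul]
  rw [sum_comm]
  exact sum_congr rfl fun i _ => sum_congr rfl fun j _ => by ring

lemma spectralPenalty_le_factorPenalty {m n k : ℕ} {f : ℝ → ℝ}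
    (hconc : ConcaveOn ℝ (Set.Ici 0) f) (hmono : MonotoneOn f (Set.Ici 0)) (hf0 : f 0 = 0)
    (B : Matrix (Fin m) (Fin k) ℝ) (C : Matrix (Fin n) (Fin k) ℝ)
    (hX : (B * C.transpose).rank ≤ k) :
    spectralPenalty f (B * C.transpose) ≤ factorPenalty f B C := by
  rw [spectralPenalty_eq_sum_range hf0 _ hX]
  refine hconc.sum_le_sum_of_compl_sum hmono (fun i => colNorm B i * colNorm C i) _
    (fun i => mul_nonneg (norm_nonneg _) (norm_nonneg _)) (singVal_nonneg _) fun J => ?_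
  have h := LinearMap.tail_singularValues_le (Matrix.toEuclideanLin (B * C.transpose))
    finrank_euclideanSpace_fin (fun i => WithLp.toLp 2 (B.col i)) (fun i => WithLp.toLp 2 (C.col i))
    (toEuclideanLin_mul_transpose_apply B C) J
  refine le_trans ?_ h
  rw [sum_filter, Fin.sum_univ_eq_sum_range (fun i => if #J ≤ i then
    (Matrix.toEuclideanLin (B * C.transpose)).singularValues i else 0), ← sum_filter]
  -- `k` may exceed `n`; the nonzero terms have index below the rank, hence below `n`.
  rw [← sum_filter_ne_zero]
  refine sum_le_sum_of_subset_of_nonneg (fun i hi => ?_) fun i _ _ => singVal_nonneg _ i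
  obtain ⟨hi, hne⟩ := mem_filter.1 hi
  have h1 : i < (B * C.transpose).rank := by
    by_contra hlt
    exact hne ((singVal_eq_zero_iff_rank_le _ _).2 (not_lt.1 hlt))
  have h2 := (B * C.transpose).rank_le_width
  simp only [mem_filter, mem_range, mem_Ico] at hi ⊢
  omega

lemma exists_isSVD {m n k : ℕ} (X : Matrix (Fin m) (Fin n) ℝ) (hX : X.rank ≤ k) :
    ∃ (U : Matrix (Fin m) (Fin k) ℝ) (V : Matrix (Fin n) (Fin k) ℝ), IsSVD X U V := by
  obtain ⟨y, x, hx, hx0, hTy, hxT⟩ :=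
    (Matrix.toEuclideanLin X).exists_singular_vectors finrank_euclideanSpace_fin
  have hlt : ∀ i : ℕ, singVal X i ≠ 0 → i < n := fun i hi => by
    have := X.rank_le_width
    have := mt (singVal_eq_zero_iff_rank_le X i).2 hi
    omega
  -- Columns from `n` on are padded with zeros; their singular values vanish.
  refine ⟨Matrix.of fun a i => if h : i.1 < n then x ⟨i, h⟩ a else 0,
    Matrix.of fun a i => if h : i.1 < n then y ⟨i, h⟩ a else 0, ?_, ?_, ?_⟩
  · have := hx.comp (fun i : {i : Fin k // singVal X i ≠ 0} =>
      (⟨⟨i.1, hlt _ i.2⟩, i.2⟩ : {i : Fin n // (Matrix.toEuclideanLin X).singularValues i ≠ 0}))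
      (fun i j hij => by simpa [Subtype.ext_iff, Fin.ext_iff] using hij)
    refine (congrArg (Orthonormal ℝ) ?_).mpr this
    ext i a
    simp [hlt _ i.2]
  · have := y.orthonormal.comp (fun i : {i : Fin k // singVal X i ≠ 0} =>
      (⟨i.1, hlt _ i.2⟩ : Fin n))
      (fun i j hij => by simpa [Subtype.ext_iff, Fin.ext_iff] using hij)
    refine (congrArg (Orthonormal ℝ) ?_).mpr this
    ext i a
    simp [hlt _ i.2]
  · ext a b
    set g : ℕ → ℝ := fun i => if h : i < n then singVal X i * (x ⟨i, h⟩ a * y ⟨i, h⟩ b) else 0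
      with hg
    have hR : (∑ i : Fin k, singVal X i • Matrix.vecMulVec
        ((Matrix.of fun a (i : Fin k) => if h : i.1 < n then x ⟨i, h⟩ a else 0).col i)
        ((Matrix.of fun a (i : Fin k) => if h : i.1 < n then y ⟨i, h⟩ a else 0).col i)) a b =
        ∑ i ∈ range k, g i := by
      rw [Matrix.sum_apply, ← Fin.sum_univ_eq_sum_range]
      refine sum_congr rfl fun i _ => ?_
      by_cases h : i.1 < n <;> simp [hg, h, Matrix.vecMulVec_apply]
    have hL : X a b = ∑ i ∈ range n, g i := by
      have h1 : X a b = (Matrix.toEuclideanLin X (EuclideanSpace.single b 1)) a := by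
        simp [Matrix.toLpLin_apply]
      rw [h1, ← y.sum_repr' (EuclideanSpace.single b (1 : ℝ)), ← Fin.sum_univ_eq_sum_range]
      simp only [map_sum, map_smul, hTy, WithLp.ofLp_sum, Finset.sum_apply]
      refine sum_congr rfl fun i _ => ?_
      simp [hg, singVal, EuclideanSpace.inner_single_right]
      ring
    have hg0 : ∀ i, X.rank ≤ i → g i = 0 := fun i hi => by
      simp [hg, (singVal_eq_zero_iff_rank_le X i).2 hi]
    have key : ∀ l, X.rank ≤ l → ∑ i ∈ range l, g i = ∑ i ∈ range X.rank, g i := fun l hl =>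
      (sum_subset (range_mono hl) fun i _ hi => hg0 i (by simpa using hi)).symm
    rw [hR, hL, key n X.rank_le_width, key k hX]

lemma colNorm_balancedFactor {m n l k : ℕ} (X : Matrix (Fin m) (Fin n) ℝ)
    (W : Matrix (Fin l) (Fin k) ℝ)
    (hW : Orthonormal ℝ
      (fun i : {i : Fin k // singVal X i ≠ 0} => WithLp.toLp 2 (W.col i.1))) (i : Fin k) :
    colNorm (balancedFactor X W) i = Real.sqrt (singVal X i) := by
  have h : WithLp.toLp 2 ((balancedFactor X W).col i) =
      Real.sqrt (singVal X i) • WithLp.toLp 2 (W.col i) := by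
    ext a
    simp [balancedFactor]
  rw [colNorm, h, norm_smul, Real.norm_of_nonneg (Real.sqrt_nonneg _)]
  by_cases hi : singVal X i = 0
  · simp [hi]
  · rw [hW.1 ⟨i, hi⟩, mul_one]

lemma IsSVD.balancedFactor_mul_transpose {m n k : ℕ} {X : Matrix (Fin m) (Fin n) ℝ}
    {U : Matrix (Fin m) (Fin k) ℝ} {V : Matrix (Fin n) (Fin k) ℝ} (h : IsSVD X U V) :
    balancedFactor X U * (balancedFactor X V).transpose = X := by
  refine Eq.trans ?_ h.eq_sum.symm
  ext a b
  rw [Matrix.sum_apply, Matrix.mul_apply]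
  refine sum_congr rfl fun i _ => ?_
  have := Real.mul_self_sqrt (singVal_nonneg X i)
  simp only [balancedFactor, Matrix.of_apply, Matrix.transpose_apply, Matrix.smul_apply,
    Matrix.vecMulVec_apply, Matrix.col_apply, smul_eq_mul]
  linear_combination (U a i * V b i) * this

lemma IsSVD.factorPenalty_balancedFactor {m n k : ℕ} {f : ℝ → ℝ} (hf0 : f 0 = 0)
    {X : Matrix (Fin m) (Fin n) ℝ} (hX : X.rank ≤ k)
    {U : Matrix (Fin m) (Fin k) ℝ} {V : Matrix (Fin n) (Fin k) ℝ} (h : IsSVD X U V) :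
    factorPenalty f (balancedFactor X U) (balancedFactor X V) = spectralPenalty f X := by
  rw [spectralPenalty_eq_sum_range hf0 X hX, factorPenalty, ← Fin.sum_univ_eq_sum_range
    (fun i => f (singVal X i))]
  refine sum_congr rfl fun i _ => ?_
  rw [colNorm_balancedFactor X U h.left_orthonormal, colNorm_balancedFactor X V h.right_orthonormal,
    Real.mul_self_sqrt (singVal_nonneg X i)]

end MatrixFactors

theorem theorem1 {m n k : ℕ} (f : ℝ → ℝ)
    (hconc : ConcaveOn ℝ (Set.Ici 0) f) (hmono : MonotoneOn f (Set.Ici 0)) (hf0 : f 0 = 0)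
    (X : Matrix (Fin m) (Fin n) ℝ) (hX : X.rank ≤ k) :
    IsLeast {r : ℝ | ∃ (B : Matrix (Fin m) (Fin k) ℝ) (C : Matrix (Fin n) (Fin k) ℝ),
        B * C.transpose = X ∧ r = factorPenalty f B C} (spectralPenalty f X) ∧
    (∃ (U : Matrix (Fin m) (Fin k) ℝ) (V : Matrix (Fin n) (Fin k) ℝ), IsSVD X U V) ∧
    (∀ (U : Matrix (Fin m) (Fin k) ℝ) (V : Matrix (Fin n) (Fin k) ℝ), IsSVD X U V →
      balancedFactor X U * (balancedFactor X V).transpose = X ∧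
      factorPenalty f (balancedFactor X U) (balancedFactor X V) = spectralPenalty f X) := by
  obtain ⟨U, V, hUV⟩ := exists_isSVD X hX
  refine ⟨⟨⟨_, _, hUV.balancedFactor_mul_transpose, (hUV.factorPenalty_balancedFactor hf0 hX).symm⟩,
    ?_⟩, ⟨U, V, hUV⟩, fun U V h =>
      ⟨h.balancedFactor_mul_transpose, h.factorPenalty_balancedFactor hf0 hX⟩⟩
  rintro _ ⟨B, C, rfl, rfl⟩
  exact spectralPenalty_le_factorPenalty hconc hmono hf0 B C hX
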